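/- Let $d\ge 1$, let $H\in\mathbb{R}^{d\times d}$ be invertible and let $S\in\mathbb{R}^{d\times d}$ be symmetric positive definite. Let $G_1,G_2,\dots$ be i.i.d. Gaussian random vectors in $\mathbb{R}^d$ with mean zero and covariance matrix $V:=H^{-1}SH^{-1}$ (so that $V$ is symmetric positive definite; this is automatic if $H$ is symmetric), and let $M_t:=\frac1t\sum_{j=1}^t G_j$ for $t\ge 1$. Let $\kappa(V)$ be the condition number of $V$ in the $\ell^2$ operator norm, let $C_d:=d\,2^d\,\Gamma(\frac{d+1}{2})/\pi^{\frac{d-1}{2}}$, and let $W_{-1}(x)$, for $-1/e\le x<0$, be the lower branch of the Lambert $W$ function, that is, the most negative real solution $z$ of $ze^z=x$. Let $\alpha\in(0,1)$, $\epsilon\in(0,1)$ and $t_0>0$. Then 1. with probability at least $1-\alpha$, for all integers $t\ge1$, $$\|V^{-1/2}M_t\|_\infty\le 1.7\sqrt{\frac{\log\log(2t)+0.72\log(10.4\,d/\alpha)}{t}};$$ 2. with probability at least $1-\alpha$, for all integers $t\ge1$, $$\|V^{-1/2}M_t\|_2\le\sqrt{\frac{\bigl\{1+\frac{t_0}{t\lambda^*}\bigr\}\bigl\{d\log\bigl(1+\frac{t\lambda^*}{t_0}\bigr)+2\log\frac1\alpha\bigr\}}{t}},$$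 and this holds for each of the two choices $\lambda^*=-W_{-1}(-\alpha^2/e)$ and $\lambda^*=-W_{-1}(-\alpha^2/e)-1$; 3. with probability at least $1-\alpha$, for all integers $t\ge1$, $$\|V^{-1/2}M_t\|_2\le\frac{2}{1-\epsilon}\sqrt{\frac{1.4\log\log(2t\kappa(V))+L_{d,\epsilon,\alpha}(V)}{t}},\qquad L_{d,\epsilon,\alpha}(V):=\log\Bigl(\frac{5.2\,C_d}{\alpha}\Bigr)+(d-1)\log\Bigl(\frac{3\sqrt{\kappa(V)}}{\epsilon}\Bigr).$$ -/

import Mathlib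

open MeasureTheory ProbabilityTheory
open scoped MatrixOrder

noncomputable section

namespace TimeUniform

/-- `V^{-1/2} x`: the inverse of the positive semidefinite square root of `V`, applied to `x`. -/
def standardize {d : ℕ} (V : Matrix (Fin d) (Fin d) ℝ) (x : EuclideanSpace ℝ (Fin d)) :
    EuclideanSpace ℝ (Fin d) :=
  Matrix.toEuclideanCLM (𝕜 := ℝ) (CFC.sqrt V)⁻¹ x

/-- The condition number `κ(V) = ‖V‖₂ ‖V⁻¹‖₂` for the `ℓ²` operator norm. -/
def condNumber {d : ℕ} (V : Matrix (Fin d) (Fin d) ℝ) : ℝ :=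
  ‖Matrix.toEuclideanCLM (𝕜 := ℝ) V‖ * ‖Matrix.toEuclideanCLM (𝕜 := ℝ) V⁻¹‖

/-- The lower branch `W₋₁(x)` of the Lambert `W` function, for `-1/e ≤ x < 0`:
the most negative real solution `z` of `z e^z = x`. -/
def lambertWLower (x : ℝ) : ℝ := sInf {z : ℝ | z * Real.exp z = x}

/-- The running mean `M_t` of the first `t` vectors; the sequence starts at index `0`,
so that `G j` is the `(j+1)`-st vector. -/
def runningMean {Ω : Type*} {d : ℕ} (G : ℕ → Ω → EuclideanSpace ℝ (Fin d)) (t : ℕ) (ω : Ω) :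
    EuclideanSpace ℝ (Fin d) :=
  (t : ℝ)⁻¹ • ∑ j ∈ Finset.range t, G j ω

/-- The law-of-the-iterated-logarithm boundary with a union bound. The norm is the one of the
function space `Fin d → ℝ`, that is, the sup norm. -/
def regionLILUB {d : ℕ} (V : Matrix (Fin d) (Fin d) ℝ) (α : ℝ) (t : ℕ) :
    Set (EuclideanSpace ℝ (Fin d)) :=
  {x | ‖(WithLp.ofLp (standardize V x) : Fin d → ℝ)‖ ≤
    1.7 * √((Real.log (Real.log (2 * t)) + 0.72 * Real.log (10.4 * d / α)) / t)}

/-- The Gaussian mixture boundary with tuning parameters `t₀` and `lam`. -/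
def regionGM {d : ℕ} (V : Matrix (Fin d) (Fin d) ℝ) (α t₀ lam : ℝ) (t : ℕ) :
    Set (EuclideanSpace ℝ (Fin d)) :=
  {x | ‖standardize V x‖ ≤
    √((1 + t₀ / (t * lam)) * (d * Real.log (1 + t * lam / t₀) + 2 * Real.log (1 / α)) / t)}

/-- The constant `C_d = d 2^d Γ((d+1)/2) / π^{(d-1)/2}`. -/
def netConst (d : ℕ) : ℝ :=
  d * 2 ^ d * Real.Gamma (((d : ℝ) + 1) / 2) / Real.pi ^ (((d : ℝ) - 1) / 2)

/-- The quantity `L_{d,ε,α}(V)`. -/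
def netLog {d : ℕ} (V : Matrix (Fin d) (Fin d) ℝ) (ε α : ℝ) : ℝ :=
  Real.log (5.2 * netConst d / α) + ((d : ℝ) - 1) * Real.log (3 * √(condNumber V) / ε)

/-- The law-of-the-iterated-logarithm boundary obtained from `ε`-nets. -/
def regionLILEN {d : ℕ} (V : Matrix (Fin d) (Fin d) ℝ) (ε α : ℝ) (t : ℕ) :
    Set (EuclideanSpace ℝ (Fin d)) :=
  {x | ‖standardize V x‖ ≤
    2 / (1 - ε) * √((1.4 * Real.log (Real.log (2 * t * condNumber V)) + netLog V ε α) / t)}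

end TimeUniform

end

/-! Standardizing by `V^{-1/2}` turns the walk into a sum `S_t` of independent standard Gaussian
vectors, and each claim becomes a time-uniform bound on `S_t`. All three rest on Ville's inequality:
if `f n (S_n)` is a nonnegative supermartingale starting at 1, it ever reaches `1/a` with
probability at most `a`.

With `f n x = exp(l⟨u,x⟩ - n l²/2)`, Ville bounds the chance that the walk in direction `u` crosses
a line. Stitching one line per epoch `2.04^k ≤ t < 2.04^(k+1)`, with error shares proportional to
`(k+1)^(-7/5)`, gives an iterated-logarithm bound in one direction (`measure_lil_crossing_le`).
Claim 1 is the union bound over the `2d` directions `±e_i`. Claim 3 is the union bound over an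
`ε`-net of the sphere with at most `2d(3/ε)^(d-1)` points, some point `u` of which satisfies
`(1-ε)‖x‖ ≤ ⟨u,x⟩`. The net lives in standardized coordinates, so `κ(V) ≥ 1` and `C_d ≥ 2d` only
enlarge the stated boundary.

For claim 2, averaging these exponentials over a centred Gaussian parameter with covariance `I/b`
gives `(b/(n+b))^(d/2) exp(‖x‖²/(2(n+b)))`. Take `b = t₀/λ*`; any positive `λ*` works, so all that
is needed of the Lambert function is `W₋₁ < -1`. -/

noncomputable section

namespace TimeUniform

/-! ### Ville's maximal inequality for random walks -/

section Ville

variable {Ω E : Type*} [MeasurableSpace Ω] {P : Measure Ω} [IsProbabilityMeasure P]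
  [MeasurableSpace E]

/-- Integrating a nonnegative function of two independent variables, first over the second one. -/
theorem setLIntegral_add_le_of_indepFun {T : Type*} [MeasurableSpace T] [Add E] [MeasurableAdd₂ E]
    {X : Ω → T} {Z : Ω → E} {μ : Measure E} (hX : Measurable X) (hZ : Measurable Z)
    (hXZ : IndepFun X Z P) (hμ : P.map Z = μ) {g : T → E} (hg : Measurable g)
    {D : Set T} (hD : MeasurableSet D) {φ ψ : E → ENNReal} (hφ : Measurable φ)
    (hψ : Measurable ψ) (h : ∀ x, ∫⁻ z, φ (x + z) ∂μ ≤ ψ x) :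
    ∫⁻ ω in X ⁻¹' D, φ (g (X ω) + Z ω) ∂P ≤ ∫⁻ ω in X ⁻¹' D, ψ (g (X ω)) ∂P := by
  have : IsProbabilityMeasure μ := hμ ▸ Measure.isProbabilityMeasure_map hZ.aemeasurable
  have hm : Measurable fun p : T × E ↦ D.indicator (fun _ ↦ (1 : ENNReal)) p.1 * φ (g p.1 + p.2) :=
    ((measurable_const.indicator hD).comp measurable_fst).mul
      (hφ.comp ((hg.comp measurable_fst).add measurable_snd))
  have hind : ∀ F : T → Ω → ENNReal, ∫⁻ ω in X ⁻¹' D, F (X ω) ω ∂P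
      = ∫⁻ ω, D.indicator (fun _ ↦ (1 : ENNReal)) (X ω) * F (X ω) ω ∂P := by
    intro F
    rw [← lintegral_indicator (hX hD)]
    congr 1 with ω
    by_cases hω : X ω ∈ D <;> simp [Set.indicator, hω]
  rw [hind fun x ω ↦ φ (g x + Z ω), hind fun x _ ↦ ψ (g x)]
  calc ∫⁻ ω, D.indicator (fun _ ↦ (1 : ENNReal)) (X ω) * φ (g (X ω) + Z ω) ∂P
      = ∫⁻ p, D.indicator (fun _ ↦ (1 : ENNReal)) p.1 * φ (g p.1 + p.2)
          ∂(P.map fun ω ↦ (X ω, Z ω)) := by rw [lintegral_map hm (by fun_prop)]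
    _ = ∫⁻ x, ∫⁻ z, D.indicator (fun _ ↦ (1 : ENNReal)) x * φ (g x + z) ∂μ ∂(P.map X) := by
        rw [(indepFun_iff_map_prod_eq_prod_map_map hX.aemeasurable hZ.aemeasurable).1 hXZ, hμ,
          lintegral_prod _ hm.aemeasurable]
    _ ≤ ∫⁻ x, D.indicator (fun _ ↦ (1 : ENNReal)) x * ψ (g x) ∂(P.map X) := by
        refine lintegral_mono fun x ↦ ?_
        rw [lintegral_const_mul _ (by fun_prop)]
        gcongr
        exact h _
    _ = _ := by
        rw [lintegral_map (f := fun x ↦ D.indicator (fun _ ↦ (1 : ENNReal)) x * ψ (g x))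
          ((measurable_const.indicator hD).mul (hψ.comp hg)) hX]

/-- Ville's maximal inequality for a nonnegative space-time superharmonic function along a random
walk with independent and identically distributed steps. -/
theorem ville_of_superharmonic [AddCommMonoid E] [MeasurableAdd₂ E] {Z : ℕ → Ω → E} {μ : Measure E}
    (hZ : ∀ j, Measurable (Z j)) (hindep : iIndepFun Z P) (hlaw : ∀ j, P.map (Z j) = μ)
    {f : ℕ → E → ENNReal} (hf : ∀ n, Measurable (f n))
    (hstep : ∀ n x, ∫⁻ z, f (n + 1) (x + z) ∂μ ≤ f n x) (c : ENNReal) :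
    c * P {ω | ∃ n, c ≤ f n (∑ j ∈ Finset.range n, Z j ω)} ≤ f 0 0 := by
  set S : ℕ → Ω → E := fun n ω ↦ ∑ j ∈ Finset.range n, Z j ω with hSdef
  have hSm : ∀ n, Measurable (S n) := fun n ↦ Finset.measurable_sum _ fun i _ ↦ hZ i
  have hSsucc : ∀ n ω, S (n + 1) ω = S n ω + Z n ω := fun n ω ↦ Finset.sum_range_succ _ _
  set A : ℕ → Set Ω := fun n ↦ {ω | ∃ k < n, c ≤ f k (S k ω)} with hA
  have hlevel : ∀ n, MeasurableSet {ω | c ≤ f n (S n ω)} := fun n ↦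
    measurableSet_le measurable_const ((hf n).comp (hSm n))
  have hAsucc : ∀ n, A (n + 1) = A n ∪ {ω | c ≤ f n (S n ω)} := by
    intro n
    ext ω
    simp only [hA, Set.mem_ofPred_eq, Set.mem_union, Nat.lt_succ_iff_lt_or_eq]
    constructor
    · rintro ⟨k, hk | rfl, h⟩
      exacts [Or.inl ⟨k, hk, h⟩, Or.inr h]
    · rintro (⟨k, hk, h⟩ | h)
      exacts [⟨k, Or.inl hk, h⟩, ⟨n, Or.inr rfl, h⟩]
  have hAm : ∀ n, MeasurableSet (A n) := by
    intro n
    induction n with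
    | zero => simp [hA]
    | succ n ih => rw [hAsucc]; exact ih.union (hlevel n)
  -- Not having crossed up to time `n` is an event of the first `n` steps, hence independent of `Z
  -- n`; integrating out `Z n` by `hstep` replaces conditional expectation.
  have hcond : ∀ n, ∫⁻ ω in (A (n + 1))ᶜ, f (n + 1) (S (n + 1) ω) ∂P
      ≤ ∫⁻ ω in (A (n + 1))ᶜ, f n (S n ω) ∂P := by
    intro n
    let T : Ω → (Finset.range n → E) := fun ω i ↦ Z i ω
    have hT : Measurable T := measurable_pi_lambda _ fun i ↦ hZ i
    -- Every partial sum up to time `n` is a function of the single tuple `T`; coordinates past `k`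
    -- contribute 0.
    let g : ℕ → (Finset.range n → E) → E := fun k τ ↦ ∑ i : Finset.range n, if (i : ℕ) < k then τ i else 0
    have hg : ∀ k, Measurable (g k) := fun k ↦ by
      refine Finset.measurable_sum _ fun i _ ↦ ?_
      by_cases h : (i : ℕ) < k
      · simpa [h] using measurable_pi_apply i
      · simp [h]
    have hgS : ∀ k ≤ n, ∀ ω, g k (T ω) = S k ω := by
      intro k hk ω
      simp only [g, T]
      rw [Finset.sum_coe_sort (Finset.range n) (fun i ↦ if i < k then Z i ω else 0),
        ← Finset.sum_filter]
      refine Finset.sum_congr ?_ fun _ _ ↦ rfl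
      ext i
      simp only [Finset.mem_filter, Finset.mem_range]
      omega
    let D : Set (Finset.range n → E) := {τ | ∃ k < n + 1, c ≤ f k (g k τ)}ᶜ
    have hD : MeasurableSet D := by
      refine MeasurableSet.compl ?_
      have : {τ : Finset.range n → E | ∃ k < n + 1, c ≤ f k (g k τ)}
          = ⋃ k, ⋃ (_ : k < n + 1), {τ | c ≤ f k (g k τ)} := by ext; simp
      rw [this]
      exact MeasurableSet.iUnion fun k ↦ MeasurableSet.iUnion fun _ ↦
        measurableSet_le measurable_const ((hf k).comp (hg k))
    have hDA : T ⁻¹' D = (A (n + 1))ᶜ := by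
      ext ω
      simp only [D, hA, Set.mem_preimage, Set.mem_compl_iff, Set.mem_ofPred_eq, not_iff_not]
      refine exists_congr fun k ↦ and_congr_right fun hk ↦ ?_
      rw [hgS k (by omega)]
    have hind : IndepFun T (Z n) P := by
      have := hindep.indepFun_finset (Finset.range n) {n} (by simp) hZ
      exact this.comp (φ := id) (ψ := fun τ : (({n} : Finset ℕ) → E) ↦ τ ⟨n, by simp⟩)
        measurable_id (measurable_pi_apply _)
    have := setLIntegral_add_le_of_indepFun hT (hZ n) hind (hlaw n) (hg n) hD (hf (n + 1)) (hf n)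
      (hstep n)
    rw [hDA] at this
    simpa only [hSsucc, hgS n le_rfl] using this
  -- Optional stopping by hand: paths that have crossed are charged `c`, the others carry their
  -- current value. The total is bounded by the initial value.
  have hmain : ∀ n, c * P (A n) + ∫⁻ ω in (A n)ᶜ, f n (S n ω) ∂P ≤ f 0 0 := by
    intro n
    induction n with
    | zero => simp [hA, hSdef]
    | succ n ih =>
      set B : Set Ω := (A n)ᶜ ∩ {ω | c ≤ f n (S n ω)} with hB
      have hBm : MeasurableSet B := (hAm n).compl.inter (hlevel n)
      have hPA : P (A (n + 1)) ≤ P (A n) + P B := by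
        refine (measure_mono ?_).trans (measure_union_le _ _)
        rw [hAsucc]
        intro ω hω
        by_cases h : ω ∈ A n
        · exact Or.inl h
        · exact Or.inr ⟨h, hω.resolve_left h⟩
      have hsplit : (A n)ᶜ = B ∪ (A (n + 1))ᶜ := by
        ext ω
        simp only [hB, hAsucc, Set.mem_union, Set.mem_inter_iff, Set.mem_compl_iff]
        tauto
      have hdisj : Disjoint B (A (n + 1))ᶜ := by
        rw [Set.disjoint_compl_right_iff_subset, hAsucc]
        exact fun ω hω ↦ Or.inr hω.2
      have hcB : c * P B ≤ ∫⁻ ω in B, f n (S n ω) ∂P := by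
        rw [← setLIntegral_const]
        exact setLIntegral_mono_ae ((hf n).comp (hSm n)).aemeasurable
          (Filter.Eventually.of_forall fun ω hω ↦ hω.2)
      calc c * P (A (n + 1)) + ∫⁻ ω in (A (n + 1))ᶜ, f (n + 1) (S (n + 1) ω) ∂P
          ≤ c * (P (A n) + P B) + ∫⁻ ω in (A (n + 1))ᶜ, f n (S n ω) ∂P := by
            gcongr ?_ + ?_
            · gcongr
            · exact hcond n
        _ ≤ c * P (A n) + (∫⁻ ω in B, f n (S n ω) ∂P
              + ∫⁻ ω in (A (n + 1))ᶜ, f n (S n ω) ∂P) := by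
            rw [mul_add, add_assoc]
            gcongr
        _ = c * P (A n) + ∫⁻ ω in (A n)ᶜ, f n (S n ω) ∂P := by
            rw [hsplit, lintegral_union (hAm (n + 1)).compl hdisj]
        _ ≤ f 0 0 := ih
  have hUnion : {ω | ∃ n, c ≤ f n (S n ω)} = ⋃ n, A n := by
    ext ω
    simp only [hA, Set.mem_ofPred_eq, Set.mem_iUnion]
    constructor
    · rintro ⟨n, h⟩
      exact ⟨n + 1, n, n.lt_succ_self, h⟩
    · rintro ⟨_, k, _, h⟩
      exact ⟨k, h⟩
  have hmono : Monotone A := by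
    rintro m n hmn ω ⟨k, hk, h⟩
    exact ⟨k, hk.trans_le hmn, h⟩
  rw [hUnion, hmono.measure_iUnion, ENNReal.mul_iSup]
  exact iSup_le fun n ↦ le_self_add.trans (hmain n)

/-- The probability form of `ville_of_superharmonic`. -/
theorem measure_exists_exp_le_of_superharmonic [AddCommMonoid E] [MeasurableAdd₂ E]
    {Z : ℕ → Ω → E} {μ : Measure E}
    (hZ : ∀ j, Measurable (Z j)) (hindep : iIndepFun Z P) (hlaw : ∀ j, P.map (Z j) = μ)
    {f : ℕ → E → ENNReal} (hf : ∀ n, Measurable (f n))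
    (hstep : ∀ n x, ∫⁻ z, f (n + 1) (x + z) ∂μ ≤ f n x) (h0 : f 0 0 ≤ 1) {a : ℝ} (ha : 0 < a) :
    P {ω | ∃ n, ENNReal.ofReal a⁻¹ ≤ f n (∑ j ∈ Finset.range n, Z j ω)} ≤ ENNReal.ofReal a := by
  have h := (ville_of_superharmonic hZ hindep hlaw hf hstep (ENNReal.ofReal a⁻¹)).trans h0
  rw [ENNReal.ofReal_inv_of_pos ha, mul_comm, ← div_eq_mul_inv] at h
  have := (ENNReal.div_le_iff (by simpa using ha) ENNReal.ofReal_ne_top).1 h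
  rw [ENNReal.ofReal_inv_of_pos ha]
  simpa using this

end Ville

/-! ### Exponential and mixture supermartingales of the Gaussian walk -/

section Gaussian

open Real

variable {d : ℕ}

theorem map_inner_stdGaussian (u : EuclideanSpace ℝ (Fin d)) (hu : ‖u‖ = 1) :
    (stdGaussian (EuclideanSpace ℝ (Fin d))).map (fun x ↦ inner ℝ u x) = gaussianReal 0 1 := by
  have h := IsGaussian.map_eq_gaussianReal (μ := stdGaussian (EuclideanSpace ℝ (Fin d))) (innerSL ℝ u)
  rw [variance_dual_stdGaussian, integral_strongDual_stdGaussian, innerSL_apply_norm, hu] at h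
  simpa using h

theorem lintegral_exp_mul_inner_stdGaussian (u : EuclideanSpace ℝ (Fin d)) (hu : ‖u‖ = 1) (l : ℝ) :
    ∫⁻ z, ENNReal.ofReal (exp (l * inner ℝ u z)) ∂(stdGaussian (EuclideanSpace ℝ (Fin d)))
      = ENNReal.ofReal (exp (l ^ 2 / 2)) := by
  have hm : Measurable fun x : EuclideanSpace ℝ (Fin d) ↦ inner ℝ u x := by fun_prop
  rw [← lintegral_map (f := fun y : ℝ ↦ ENNReal.ofReal (exp (l * y))) (by fun_prop) hm,
    map_inner_stdGaussian u hu,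
    ← ofReal_integral_eq_lintegral_ofReal (integrable_exp_mul_gaussianReal l)
      (Filter.Eventually.of_forall fun _ ↦ (exp_pos _).le)]
  have := congrFun (mgf_id_gaussianReal (μ := 0) (v := 1)) l
  simp only [mgf, id] at this
  rw [this]
  simp

/-- The one-dimensional Gaussian mixture identity. -/
theorem lintegral_exp_sq_gaussianReal {b : ℝ} (hb : 0 < b) (s : ℝ) :
    ∫⁻ z, ENNReal.ofReal (√(b / (b + 1)) * exp ((s + z) ^ 2 / (2 * (b + 1)))) ∂(gaussianReal 0 1)
      = ENNReal.ofReal (exp (s ^ 2 / (2 * b))) := by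
  have hv : 0 < (b + 1) / b := by positivity
  -- Completing the square leaves the Gaussian density with mean `s / b` and variance `(b + 1) / b`.
  set v : NNReal := ⟨(b + 1) / b, hv.le⟩ with hvdef
  have hv0 : v ≠ 0 := fun h ↦ hv.ne' (congrArg NNReal.toReal h)
  have hvc : (v : ℝ) = (b + 1) / b := rfl
  rw [gaussianReal_of_var_ne_zero _ one_ne_zero,
    lintegral_withDensity_eq_lintegral_mul _ (measurable_gaussianPDF _ _) (by fun_prop)]
  have key : ∀ z, (gaussianPDF 0 1 * fun z ↦ ENNReal.ofReal
      (√(b / (b + 1)) * exp ((s + z) ^ 2 / (2 * (b + 1))))) z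
      = ENNReal.ofReal (exp (s ^ 2 / (2 * b))) * ENNReal.ofReal (gaussianPDFReal (s / b) v z) := by
    intro z
    simp only [Pi.mul_apply, gaussianPDF]
    rw [← ENNReal.ofReal_mul (gaussianPDFReal_nonneg _ _ _), ← ENNReal.ofReal_mul (exp_pos _).le]
    congr 1
    simp only [gaussianPDFReal, hvc, NNReal.coe_one, mul_one, sub_zero]
    have e1 : √(2 * π * ((b + 1) / b)) = √(2 * π) * (√(b / (b + 1)))⁻¹ := by
      rw [sqrt_mul (by positivity), ← sqrt_inv, inv_div]
    have e2 : exp (-z ^ 2 / 2) * exp ((s + z) ^ 2 / (2 * (b + 1)))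
        = exp (s ^ 2 / (2 * b)) * exp (-(z - s / b) ^ 2 / (2 * ((b + 1) / b))) := by
      rw [← exp_add, ← exp_add]
      congr 1
      field_simp
      ring
    rw [e1, mul_inv, inv_inv]
    linear_combination ((√(2 * π))⁻¹ * √(b / (b + 1))) * e2
  simp_rw [key]
  rw [lintegral_const_mul _ (by fun_prop), lintegral_gaussianPDFReal_eq_one _ hv0, mul_one]

/-- Integrand and measure both factor over coordinates, which reduces this to the one-dimensional
identity. -/
theorem lintegral_exp_norm_sq_stdGaussian {b : ℝ} (hb : 0 < b) (x : EuclideanSpace ℝ (Fin d)) :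
    ∫⁻ z, ENNReal.ofReal (√(b / (b + 1)) ^ d * exp (‖x + z‖ ^ 2 / (2 * (b + 1)))) ∂(stdGaussian (EuclideanSpace ℝ (Fin d)))
      = ENNReal.ofReal (exp (‖x‖ ^ 2 / (2 * b))) := by
  have hprod : ∀ (r c : ℝ) (y : EuclideanSpace ℝ (Fin d)), 0 ≤ r →
      ENNReal.ofReal (r ^ d * exp (‖y‖ ^ 2 / c)) = ∏ i, ENNReal.ofReal (r * exp (y i ^ 2 / c)) := by
    intro r c y hr
    rw [← ENNReal.ofReal_prod_of_nonneg fun i _ ↦ by positivity, Finset.prod_mul_distrib,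
      ← exp_sum, EuclideanSpace.real_norm_sq_eq, Finset.sum_div]
    simp
  rw [← map_pi_eq_stdGaussian, lintegral_map (by fun_prop) (by fun_prop)]
  have hstep : ∀ z : Fin d → ℝ, ENNReal.ofReal (√(b / (b + 1)) ^ d *
      exp (‖x + WithLp.toLp 2 z‖ ^ 2 / (2 * (b + 1)))) = ∏ i, ENNReal.ofReal
        (√(b / (b + 1)) * exp ((x i + z i) ^ 2 / (2 * (b + 1)))) := by
    intro z
    rw [hprod _ _ _ (by positivity)]
    simp
  simp_rw [hstep]
  have hind : iIndepFun (fun (i : Fin d) (z : Fin d → ℝ) ↦ ENNReal.ofReal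
      (√(b / (b + 1)) * exp ((x i + z i) ^ 2 / (2 * (b + 1)))))
      (Measure.pi fun _ ↦ gaussianReal 0 1) := by
    refine iIndepFun_pi (X := fun i y ↦ ENNReal.ofReal
      (√(b / (b + 1)) * exp ((x i + y) ^ 2 / (2 * (b + 1))))) fun i ↦ ?_
    exact Measurable.aemeasurable (by fun_prop)
  rw [lintegral_prod_eq_prod_lintegral_of_indepFun _ _ hind (fun i ↦ by fun_prop)]
  have hcoord : ∀ i : Fin d, ∫⁻ z : Fin d → ℝ, ENNReal.ofReal
      (√(b / (b + 1)) * exp ((x i + z i) ^ 2 / (2 * (b + 1)))) ∂(Measure.pi fun _ ↦ gaussianReal 0 1)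
      = ENNReal.ofReal (1 * exp (x i ^ 2 / (2 * b))) := by
    intro i
    rw [one_mul, ← lintegral_exp_sq_gaussianReal hb (x i)]
    exact (measurePreserving_eval (fun _ : Fin d ↦ gaussianReal 0 1) i).lintegral_comp
      (f := fun y ↦ ENNReal.ofReal
        (√(b / (b + 1)) * exp ((x i + y) ^ 2 / (2 * (b + 1))))) (by fun_prop)
  simp_rw [hcoord]
  rw [← hprod 1 _ _ zero_le_one]
  simp

variable {Ω : Type*} [MeasurableSpace Ω] {P : Measure Ω} [IsProbabilityMeasure P] {Z : ℕ → Ω → EuclideanSpace ℝ (Fin d)}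

/-- The linear boundary crossing bound for one direction of a standard Gaussian random walk. -/
theorem measure_line_crossing_le (hZ : ∀ j, Measurable (Z j)) (hindep : iIndepFun Z P)
    (hlaw : ∀ j, P.map (Z j) = stdGaussian (EuclideanSpace ℝ (Fin d))) {u : EuclideanSpace ℝ (Fin d)} (hu : ‖u‖ = 1) (l : ℝ) {a : ℝ} (ha : 0 < a) :
    P {ω | ∃ n : ℕ, log a⁻¹ ≤ l * inner ℝ u (∑ j ∈ Finset.range n, Z j ω) - n * l ^ 2 / 2}
      ≤ ENNReal.ofReal a := by
  have h := measure_exists_exp_le_of_superharmonic hZ hindep hlaw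
    (f := fun n x ↦ ENNReal.ofReal (exp (l * inner ℝ u x - n * l ^ 2 / 2))) (fun n ↦ by fun_prop)
    (fun n x ↦ ?_) (by simp) ha
  · refine le_of_eq_of_le ?_ h
    congr 1
    ext ω
    refine exists_congr fun n ↦ ?_
    rw [ENNReal.ofReal_le_ofReal_iff (exp_pos _).le, log_le_iff_le_exp (by positivity)]
  · have : ∀ z : EuclideanSpace ℝ (Fin d), ENNReal.ofReal (exp (l * inner ℝ u (x + z) - ((n + 1 : ℕ) : ℝ) * l ^ 2 / 2))
        = ENNReal.ofReal (exp (l * inner ℝ u x - ((n + 1 : ℕ) : ℝ) * l ^ 2 / 2))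
          * ENNReal.ofReal (exp (l * inner ℝ u z)) := by
      intro z
      rw [← ENNReal.ofReal_mul (exp_pos _).le, ← exp_add, inner_add_right]
      ring_nf
    simp_rw [this]
    rw [lintegral_const_mul _ (by fun_prop), lintegral_exp_mul_inner_stdGaussian u hu,
      ← ENNReal.ofReal_mul (exp_pos _).le, ← exp_add]
    refine le_of_eq ?_
    congr 2
    push_cast
    ring

/-- The Gaussian mixture boundary for a standard Gaussian random walk. -/
theorem measure_mixture_crossing_le (hZ : ∀ j, Measurable (Z j)) (hindep : iIndepFun Z P)
    (hlaw : ∀ j, P.map (Z j) = stdGaussian (EuclideanSpace ℝ (Fin d))) {b : ℝ} (hb : 0 < b) {a : ℝ} (ha : 0 < a) :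
    P {ω | ∃ n : ℕ, (n + b) * (d * log (1 + n / b) + 2 * log a⁻¹)
      ≤ ‖∑ j ∈ Finset.range n, Z j ω‖ ^ 2} ≤ ENNReal.ofReal a := by
  have h := measure_exists_exp_le_of_superharmonic hZ hindep hlaw
    (f := fun n x ↦ ENNReal.ofReal (√(b / (n + b)) ^ d * exp (‖x‖ ^ 2 / (2 * (n + b)))))
    (fun n ↦ by fun_prop) (fun n x ↦ ?_) (by simp [hb.ne']) ha
  · refine le_of_eq_of_le ?_ h
    congr 1
    ext ω
    refine exists_congr fun n ↦ ?_
    have hnb : 0 < (n : ℝ) + b := by positivity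
    have hq : 0 < b / (n + b) := by positivity
    rw [ENNReal.ofReal_le_ofReal_iff (by positivity), ← log_le_log_iff (inv_pos.2 ha)
      (mul_pos (pow_pos (sqrt_pos.2 hq) d) (exp_pos _)), log_mul (by positivity) (exp_pos _).ne', log_exp, log_pow,
      log_sqrt hq.le, show b / (n + b) = (1 + n / b)⁻¹ by field_simp; ring, log_inv (1 + n / b),
      ← sub_le_iff_le_add', le_div_iff₀ (by positivity)]
    rw [show (log a⁻¹ - d * (-log (1 + n / b) / 2)) * (2 * (n + b))
      = (n + b) * (d * log (1 + n / b) + 2 * log a⁻¹) by ring]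
  · have hnb : 0 < (n : ℝ) + b := by positivity
    have : ∀ z : EuclideanSpace ℝ (Fin d), ENNReal.ofReal (√(b / ((n + 1 : ℕ) + b)) ^ d *
        exp (‖x + z‖ ^ 2 / (2 * ((n + 1 : ℕ) + b)))) = ENNReal.ofReal (√(b / (n + b)) ^ d) *
        ENNReal.ofReal (√((n + b) / (n + b + 1)) ^ d * exp (‖x + z‖ ^ 2 / (2 * (n + b + 1)))) := by
      intro z
      rw [← ENNReal.ofReal_mul (by positivity), ← mul_assoc, ← mul_pow, ← sqrt_mul (by positivity)]
      congr 2
      · congr 2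
        push_cast
        field_simp
        ring
      · push_cast
        ring_nf
    simp_rw [this]
    rw [lintegral_const_mul _ (by fun_prop), lintegral_exp_norm_sq_stdGaussian hnb,
      ← ENNReal.ofReal_mul (by positivity)]

end Gaussian

end TimeUniform

end

noncomputable section

namespace TimeUniform

/-! ### Stitching lines into an iterated-logarithm boundary -/

section Stitching

open Real

theorem two_mul_le_log_sub_log {y : ℝ} (h0 : 0 ≤ y) (h1 : y < 1) :
    2 * y ≤ log (1 + y) - log (1 - y) := by
  have h := hasSum_log_sub_log_of_abs_lt_one (x := y) (by rwa [abs_of_nonneg h0])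
  have := h.summable.le_tsum 0 fun k _ ↦ by positivity
  rw [h.tsum_eq] at this
  simpa using this

/-- The midpoint bound for the increments of `x ↦ x ^ (-p)`. -/
theorem mul_rpow_le_sub_rpow {x p : ℝ} (hx : 1 / 2 < x) (hp : 0 ≤ p) :
    p * x ^ (-p - 1) ≤ (x - 1 / 2) ^ (-p) - (x + 1 / 2) ^ (-p) := by
  have hx0 : 0 < x := by linarith
  set y : ℝ := 1 / (2 * x) with hy
  have hy0 : 0 < y := by positivity
  have hy1 : y < 1 := by rw [hy, div_lt_one (by positivity)]; linarith
  have e1 : x - 1 / 2 = x * (1 - y) := by rw [hy]; field_simp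
  have e2 : x + 1 / 2 = x * (1 + y) := by rw [hy]; field_simp
  have e3 : p * x ^ (-p - 1) = x ^ (-p) * (2 * (p * y)) := by
    rw [rpow_sub_one hx0.ne', hy]; field_simp
  rw [e1, e2, mul_rpow hx0.le (by linarith), mul_rpow hx0.le (by linarith), e3, ← mul_sub]
  refine mul_le_mul_of_nonneg_left ?_ (by positivity)
  set A := log (1 + y) with hA
  set B := log (1 - y) with hB
  have hAB : 2 * y ≤ A - B := two_mul_le_log_sub_log hy0.le hy1
  have hsum : A + B ≤ 0 := by
    rw [hA, hB, ← log_mul (by linarith) (by linarith)]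
    exact log_nonpos (by nlinarith) (by nlinarith)
  rw [rpow_def_of_pos (by linarith), rpow_def_of_pos (by linarith)]
  -- The difference splits into a factor at least 1, as `A + B = log (1 - y²) ≤ 0`, and `2 sinh` of
  -- an argument at least `p y`.
  have hs : exp (B * -p) - exp (A * -p)
      = exp (-p * (A + B) / 2) * (2 * sinh (p * (A - B) / 2)) := by
    rw [sinh_eq]
    have i1 : exp (B * -p) = exp (-p * (A + B) / 2) * exp (p * (A - B) / 2) := by
      rw [← exp_add]; ring_nf
    have i2 : exp (A * -p) = exp (-p * (A + B) / 2) * exp (-(p * (A - B) / 2)) := by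
      rw [← exp_add]; ring_nf
    rw [i1, i2]; ring
  rw [← hA, ← hB, hs]
  have h1 : 1 ≤ exp (-p * (A + B) / 2) := one_le_exp (by nlinarith)
  have h2 : p * y ≤ sinh (p * (A - B) / 2) := by
    have : p * y ≤ p * (A - B) / 2 := by nlinarith
    exact this.trans (self_le_sinh_iff.2 (by nlinarith))
  have h3 : 0 ≤ p * y := by positivity
  nlinarith

theorem sum_rpow_le (n : ℕ) :
    ∑ k ∈ Finset.range n, ((k : ℝ) + 1) ^ (-(7 / 5) : ℝ) ≤ 3.126 := by
  have hbase : (3 / 2 : ℝ) ^ (-(2 / 5) : ℝ) ≤ 0.8504 := by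
    rw [← pow_le_pow_iff_left₀ (by positivity) (by norm_num) (show 5 ≠ 0 by norm_num),
      ← rpow_natCast, ← rpow_mul (by norm_num)]
    rw [show (-(2 / 5) : ℝ) * ((5 : ℕ) : ℝ) = ((-2 : ℤ) : ℝ) by norm_num, rpow_intCast]
    norm_num
  -- The first term is kept exactly; the midpoint bound telescopes the rest from `3/2`. The limit is
  -- at most `1 + 5/2 * 0.8504 = 3.126`.
  have hmain : ∀ n : ℕ, ∑ k ∈ Finset.range (n + 1), ((k : ℝ) + 1) ^ (-(7 / 5) : ℝ)
      ≤ 1 + 5 / 2 * ((3 / 2 : ℝ) ^ (-(2 / 5) : ℝ) - ((n : ℝ) + 3 / 2) ^ (-(2 / 5) : ℝ)) := by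
    intro n
    induction n with
    | zero => simp
    | succ n ih =>
      rw [Finset.sum_range_succ]
      have h := mul_rpow_le_sub_rpow (x := (n : ℝ) + 2) (p := 2 / 5)
        (by have : (0 : ℝ) ≤ n := n.cast_nonneg
            linarith) (by norm_num)
      rw [show (-(2 / 5) - 1 : ℝ) = -(7 / 5) by norm_num,
        show (n : ℝ) + 2 - 1 / 2 = n + 3 / 2 by ring,
        show (n : ℝ) + 2 + 1 / 2 = n + 5 / 2 by ring] at h
      push_cast
      rw [show (n : ℝ) + 1 + 1 = n + 2 by ring, show (n : ℝ) + 1 + 3 / 2 = n + 5 / 2 by ring]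
      linarith
  have hle : ∑ k ∈ Finset.range n, ((k : ℝ) + 1) ^ (-(7 / 5) : ℝ)
      ≤ ∑ k ∈ Finset.range (n + 1), ((k : ℝ) + 1) ^ (-(7 / 5) : ℝ) :=
    Finset.sum_le_sum_of_subset_of_nonneg (by simp) fun _ _ _ ↦ by positivity
  have hpos : 0 ≤ ((n : ℝ) + 3 / 2) ^ (-(2 / 5) : ℝ) := by positivity
  have := hmain n
  linarith

/-- The numerical inequality between the constants of the stitched boundary. -/
theorem log_const_le : log 3.126 ≤ 1.008 * log 5.2 + 1.4 * log (log 2) := by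
  have h52 : 1.6 ≤ log 5.2 := by
    rw [le_log_iff_exp_le (by norm_num), ← pow_le_pow_iff_left₀ (exp_pos _).le (by norm_num)
      (show 5 ≠ 0 by norm_num), ← exp_nat_mul]
    rw [show ((5 : ℕ) : ℝ) * 1.6 = (8 : ℕ) * 1 by norm_num, exp_nat_mul]
    calc exp 1 ^ 8 ≤ 2.7182818286 ^ 8 := by gcongr; exact exp_one_lt_d9.le
      _ ≤ _ := by norm_num
  have hll : log 0.6931 ≤ log (log 2) :=
    log_le_log (by norm_num) (by have := log_two_gt_d9; norm_num at this ⊢; linarith)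
  have hexp : log 1.064 ≤ 0.064 := by
    have := log_le_sub_one_of_pos (x := 1.064) (by norm_num)
    norm_num at this ⊢; linarith
  -- Five times the claim. The exponent `5 * 1.008 = 5.04` exceeds 5 by 0.04, and `0.04 * log 5.2 ≥
  -- 0.064 ≥ log 1.064` supplies the last factor.
  have hmain : log (3.126 ^ 5) ≤ log (5.2 ^ 5 * 0.6931 ^ 7 * 1.064) :=
    log_le_log (by norm_num) (by norm_num)
  rw [log_mul (by norm_num) (by norm_num), log_mul (by norm_num) (by norm_num), log_pow, log_pow,
    log_pow] at hmain
  push_cast at hmain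
  norm_num at *
  linarith

/-- The level of the `k`-th line of the stitched boundary. -/
def stitchLevel (a : ℝ) (k : ℕ) : ℝ := a / 3.126 * ((k : ℝ) + 1) ^ (-(7 / 5) : ℝ)

theorem stitchLevel_pos {a : ℝ} (ha : 0 < a) (k : ℕ) : 0 < stitchLevel a k := by
  unfold stitchLevel; positivity

theorem log_inv_stitchLevel {a : ℝ} (ha : 0 < a) (k : ℕ) :
    log (stitchLevel a k)⁻¹ = log 3.126 - log a + 7 / 5 * log ((k : ℝ) + 1) := by
  have hk : (0 : ℝ) < (k : ℝ) + 1 := by positivity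
  unfold stitchLevel
  rw [log_inv, log_mul (by positivity) (by positivity), log_div ha.ne' (by norm_num),
    log_rpow hk]
  ring

theorem tsum_stitchLevel_le {a : ℝ} (ha : 0 < a) :
    ∑' k, ENNReal.ofReal (stitchLevel a k) ≤ ENNReal.ofReal a := by
  refine ENNReal.tsum_le_of_sum_range_le fun n ↦ ?_
  rw [← ENNReal.ofReal_sum_of_nonneg fun k _ ↦ (stitchLevel_pos ha k).le]
  refine ENNReal.ofReal_le_ofReal ?_
  simp only [stitchLevel]
  rw [← Finset.mul_sum, div_mul_eq_mul_div, div_le_iff₀ (by norm_num)]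
  exact mul_le_mul_of_nonneg_left (sum_rpow_le n) ha.le

/-- The argument of the square root in the law-of-the-iterated-logarithm boundary. -/
def lilArg (a : ℝ) (t : ℕ) : ℝ := log (log (2 * t)) + 0.72 * log (5.2 / a)

/-- The slope of the `k`-th line of the stitched boundary. -/
def stitchSlope (a : ℝ) (k : ℕ) : ℝ :=
  √(2 * log (stitchLevel a k)⁻¹ / (2.04 ^ k * √2.04))

theorem log_inv_stitchLevel_pos {a : ℝ} (ha : 0 < a) (ha1 : a < 1) (k : ℕ) :
    0 < log (stitchLevel a k)⁻¹ := by
  rw [log_inv_stitchLevel ha]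
  have h1 : 0 < log 3.126 := log_pos (by norm_num)
  have h2 : log a < 0 := log_neg ha ha1
  have h3 : 0 ≤ log ((k : ℝ) + 1) := log_nonneg (by linarith [k.cast_nonneg (α := ℝ)])
  linarith

/-- In epoch `k`, `k log 2.04 ≤ log t` yields `(k + 1) log 2 ≤ log (2t)`. The leftover constants are
absorbed by `log_const_le`, where `1.008 = 1.4 * 0.72`. -/
theorem log_inv_stitchLevel_le {a : ℝ} (ha : 0 < a) (ha1 : a < 1) {t k : ℕ} (ht : 1 ≤ t)
    (hk : (2.04 : ℝ) ^ k ≤ t) : log (stitchLevel a k)⁻¹ ≤ 1.4 * lilArg a t := by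
  have ht' : (1 : ℝ) ≤ t := by exact_mod_cast ht
  have hL : 0 ≤ log (t : ℝ) := log_nonneg ht'
  have h2 : 0 < log 2 := log_pos (by norm_num)
  have hη : log 2 ≤ log 2.04 := log_le_log (by norm_num) (by norm_num)
  have hkL : k * log 2.04 ≤ log t := by
    rw [← log_pow]; exact log_le_log (by positivity) hk
  have hlog2t : log (2 * t) = log 2 + log t := log_mul (by norm_num) (by positivity)
  have hprod : log 2 * ((k : ℝ) + 1) ≤ log (2 * t) := by
    rw [hlog2t]
    nlinarith [k.cast_nonneg (α := ℝ)]
  have h3 : log (log 2) + log ((k : ℝ) + 1) ≤ log (log (2 * t)) := by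
    rw [← log_mul h2.ne' (by positivity)]
    exact log_le_log (by positivity) hprod
  have h4 : log a < 0 := log_neg ha ha1
  rw [log_inv_stitchLevel ha, lilArg, log_div (by norm_num) ha.ne']
  have := log_const_le
  norm_num at *
  linarith

/-- The slope is optimal at the geometric midpoint `q` of the epoch, and `t / q` lies between
`1/√2.04` and `√2.04`. The loss is therefore bounded, and `1.4 * 4.1285 / 2 ≤ 1.7 ^ 2`. -/
theorem stitch_line_le {a : ℝ} (ha : 0 < a) (ha1 : a < 1) {t k : ℕ} (ht : 1 ≤ t)
    (hk : (2.04 : ℝ) ^ k ≤ t) (hk' : (t : ℝ) < 2.04 ^ (k + 1)) :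
    log (stitchLevel a k)⁻¹ / stitchSlope a k + t * stitchSlope a k / 2
      ≤ 1.7 * √(t * lilArg a t) := by
  have ht' : (0 : ℝ) < t := by exact_mod_cast ht
  set m := log (stitchLevel a k)⁻¹ with hm
  have hm0 : 0 < m := log_inv_stitchLevel_pos ha ha1 k
  have hmle : m ≤ 1.4 * lilArg a t := log_inv_stitchLevel_le ha ha1 ht hk
  set s : ℝ := √2.04 with hs
  have hs2 : s ^ 2 = 2.04 := sq_sqrt (by norm_num)
  have hs0 : 0 < s := sqrt_pos.2 (by norm_num)
  set q : ℝ := 2.04 ^ k * s with hq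
  have hq0 : 0 < q := by positivity
  have hl : stitchSlope a k = √(2 * m / q) := rfl
  set l := stitchSlope a k
  have hl0 : 0 < l := by rw [hl]; positivity
  have hl2 : l ^ 2 = 2 * m / q := by rw [hl]; exact sq_sqrt (by positivity)
  have hr1 : q ≤ t * s := by rw [hq]; gcongr
  have hr2 : t ≤ q * s := by
    rw [hq, mul_assoc, ← sq, hs2, ← pow_succ]; exact hk'.le
  have hsum : (q ^ 2 + t ^ 2) * s ≤ q * t * (s ^ 2 + 1) := by
    nlinarith [mul_nonneg (sub_nonneg.2 hr1) (sub_nonneg.2 hr2)]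
  have hs_up : s ≤ 1.42829 := by rw [hs]; exact sqrt_le_iff.2 (by norm_num)
  have hs_lo : 1.4282 ≤ s := by rw [hs]; exact le_sqrt_of_sq_le (by norm_num)
  have hK : (q ^ 2 + t ^ 2) ≤ 2.1285 * (q * t) := by
    have h1 : s ^ 2 + 1 ≤ 2.1285 * s := by nlinarith
    have h2 : q * t * (s ^ 2 + 1) ≤ q * t * (2.1285 * s) := by gcongr
    have h3 : (q ^ 2 + t ^ 2) * s ≤ (2.1285 * (q * t)) * s := by linarith
    exact le_of_mul_le_mul_right h3 hs0
  have hsq : (m / l + t * l / 2) ^ 2 = m * (q + t) ^ 2 / (2 * q) := by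
    have : (m / l + t * l / 2) ^ 2 = m ^ 2 / l ^ 2 + m * t + t ^ 2 * l ^ 2 / 4 := by
      field_simp; ring
    rw [this, hl2]
    field_simp
    ring
  have hbound : (m / l + t * l / 2) ^ 2 ≤ 1.7 ^ 2 * (t * lilArg a t) := by
    rw [hsq, div_le_iff₀ (by positivity)]
    have h1 : (q + t) ^ 2 ≤ 4.1285 * (q * t) := by nlinarith
    have h2 : m * (q + t) ^ 2 ≤ (1.4 * lilArg a t) * (4.1285 * (q * t)) := by
      have : 0 ≤ 4.1285 * (q * t) := by positivity
      calc m * (q + t) ^ 2 ≤ m * (4.1285 * (q * t)) := by gcongr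
        _ ≤ _ := by gcongr
    have h3 : 0 ≤ lilArg a t * (q * t) := by
      have : 0 ≤ lilArg a t := by linarith
      positivity
    nlinarith
  calc m / l + t * l / 2 ≤ √(1.7 ^ 2 * (t * lilArg a t)) := le_sqrt_of_sq_le hbound
    _ = 1.7 * √(t * lilArg a t) := by
      rw [sqrt_mul (by norm_num), sqrt_sq (by norm_num)]

variable {d : ℕ} {Ω : Type*} [MeasurableSpace Ω] {P : Measure Ω} [IsProbabilityMeasure P]
  {Z : ℕ → Ω → EuclideanSpace ℝ (Fin d)}

/-- The law-of-the-iterated-logarithm bound for one direction of a standard Gaussian random walk. -/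
theorem measure_lil_crossing_le (hZ : ∀ j, Measurable (Z j)) (hindep : iIndepFun Z P)
    (hlaw : ∀ j, P.map (Z j) = stdGaussian (EuclideanSpace ℝ (Fin d)))
    {u : EuclideanSpace ℝ (Fin d)} (hu : ‖u‖ = 1) {a : ℝ} (ha : 0 < a) (ha1 : a < 1) :
    P {ω | ∃ t : ℕ, 1 ≤ t ∧ 1.7 * √(t * lilArg a t) < inner ℝ u (∑ j ∈ Finset.range t, Z j ω)}
      ≤ ENNReal.ofReal a := by
  refine le_trans ?_ (tsum_stitchLevel_le ha)
  refine le_trans (measure_mono ?_) ((measure_iUnion_le fun k ↦ {ω | ∃ n : ℕ,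
    log (stitchLevel a k)⁻¹ ≤ stitchSlope a k * inner ℝ u (∑ j ∈ Finset.range n, Z j ω)
      - n * stitchSlope a k ^ 2 / 2}).trans (ENNReal.tsum_le_tsum fun k ↦
        measure_line_crossing_le hZ hindep hlaw hu _ (stitchLevel_pos ha k)))
  rintro ω ⟨t, ht, hω⟩
  obtain ⟨k, hk, hk'⟩ := exists_nat_pow_near (show (1 : ℝ) ≤ t by exact_mod_cast ht)
    (show (1 : ℝ) < 2.04 by norm_num)
  refine Set.mem_iUnion.2 ⟨k, t, ?_⟩
  have hm0 := log_inv_stitchLevel_pos ha ha1 k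
  have hl0 : 0 < stitchSlope a k := by unfold stitchSlope; positivity
  have h := (stitch_line_le ha ha1 ht hk hk').trans hω.le
  rw [div_add' _ _ _ hl0.ne', div_le_iff₀ hl0] at h
  linarith

end Stitching

end TimeUniform

end

noncomputable section

namespace TimeUniform

/-! ### Nets of the unit sphere and the constant `C_d` -/

section Net

open Real

theorem pow_succ_sub_pow_succ_le {a b : ℝ} (hb : 0 ≤ b) (hab : b ≤ a) (n : ℕ) :
    a ^ (n + 1) - b ^ (n + 1) ≤ (n + 1) * (a - b) * a ^ n := by
  have ha : 0 ≤ a := hb.trans hab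
  induction n with
  | zero => simp
  | succ n ih =>
    have h1 : a * (a ^ (n + 1) - b ^ (n + 1)) ≤ a * ((n + 1) * (a - b) * a ^ n) := by gcongr
    have h2 : b ^ (n + 1) * (a - b) ≤ a ^ (n + 1) * (a - b) :=
      mul_le_mul_of_nonneg_right (pow_le_pow_left₀ hb hab _) (by linarith)
    push_cast
    have h3 : a * ((n + 1) * (a - b) * a ^ n) = (n + 1) * (a - b) * a ^ (n + 1) := by ring
    have h4 : a ^ (n + 1 + 1) - b ^ (n + 1 + 1)
        = a * (a ^ (n + 1) - b ^ (n + 1)) + b ^ (n + 1) * (a - b) := by ring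
    rw [h4]
    linarith

variable {d : ℕ}

/-- The volume bound on the size of a separated subset of the unit sphere. -/
theorem card_le_of_separated_sphere (hd : 1 ≤ d) {ε : ℝ} (hε : 0 < ε) (hε1 : ε < 1)
    {N : Finset (EuclideanSpace ℝ (Fin d))} (hN : ∀ u ∈ N, ‖u‖ = 1)
    (hsep : ∀ u ∈ N, ∀ v ∈ N, u ≠ v → ε ≤ dist u v) :
    (N.card : ℝ) ≤ 2 * d * (3 / ε) ^ (d - 1) := by
  obtain ⟨n, rfl⟩ : ∃ n, d = n + 1 := ⟨d - 1, by omega⟩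
  set x := ε / 2 with hx
  have hx0 : 0 < x := by positivity
  have hx1 : x < 1 / 2 := by rw [hx]; linarith
  let μ : Measure (EuclideanSpace ℝ (Fin (n + 1))) := volume
  have hfin : Module.finrank ℝ (EuclideanSpace ℝ (Fin (n + 1))) = n + 1 := by simp
  have hball : ∀ (u : EuclideanSpace ℝ (Fin (n + 1))) {r : ℝ}, 0 ≤ r →
      μ (Metric.ball u r) = ENNReal.ofReal (r ^ (n + 1)) * μ (Metric.ball 0 1) := by
    intro u r hr
    rw [Measure.addHaar_ball μ u hr, hfin]
  have hμ0 : μ (Metric.ball 0 1) ≠ 0 := (Metric.measure_ball_pos μ 0 one_pos).ne'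
  have hμt : μ (Metric.ball 0 1) ≠ ⊤ := measure_ball_lt_top.ne
  have hdisj : (N : Set (EuclideanSpace ℝ (Fin (n + 1)))).PairwiseDisjoint
      fun u ↦ Metric.ball u x := by
    intro u hu v hv huv
    exact Metric.ball_disjoint_ball (by have := hsep u hu v hv huv; rw [hx]; linarith)
  -- The small balls lie in the shell between radii `1 - x` and `1 + x`; removing the inner ball
  -- brings the exponent from `d` down to `d - 1`.
  have hdisj0 : Disjoint (⋃ u ∈ N, Metric.ball u x)
      (Metric.ball (0 : EuclideanSpace ℝ (Fin (n + 1))) (1 - x)) := by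
    simp only [Set.disjoint_iUnion_left]
    intro u hu
    exact Metric.ball_disjoint_ball (by rw [dist_zero_right, hN u hu]; linarith)
  have hsub : (⋃ u ∈ N, Metric.ball u x) ∪
      Metric.ball (0 : EuclideanSpace ℝ (Fin (n + 1))) (1 - x) ⊆ Metric.ball 0 (1 + x) := by
    refine Set.union_subset (Set.iUnion₂_subset fun u hu ↦ ?_)
      (Metric.ball_subset_ball (by linarith))
    exact Metric.ball_subset_ball' (by rw [dist_zero_right, hN u hu]; linarith)
  have hvol := measure_mono (μ := μ) hsub
  rw [measure_union hdisj0 measurableSet_ball,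
    measure_biUnion_finset hdisj fun _ _ ↦ measurableSet_ball,
    hball 0 (by linarith : 0 ≤ 1 - x), hball 0 (by linarith : 0 ≤ 1 + x)] at hvol
  simp_rw [fun u ↦ hball u hx0.le] at hvol
  rw [Finset.sum_const, nsmul_eq_mul, ← mul_assoc, ← add_mul,
    ENNReal.mul_le_mul_iff_left hμ0 hμt, ← ENNReal.ofReal_natCast,
    ← ENNReal.ofReal_mul (by positivity), ← ENNReal.ofReal_add (by positivity)
      (pow_nonneg (by linarith) _), ENNReal.ofReal_le_ofReal_iff (by positivity)] at hvol
  have hpow := pow_succ_sub_pow_succ_le (a := 1 + x) (b := 1 - x) (by linarith) (by linarith) n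
  have h1 : (N.card : ℝ) * x ^ (n + 1) ≤ (2 * (n + 1) * (1 + x) ^ n) * x := by
    calc (N.card : ℝ) * x ^ (n + 1) ≤ (n + 1) * (1 + x - (1 - x)) * (1 + x) ^ n := by linarith
      _ = _ := by ring
  rw [pow_succ, ← mul_assoc] at h1
  have h2 := le_of_mul_le_mul_right h1 hx0
  have h3 : (N.card : ℝ) ≤ 2 * (n + 1) * ((1 + x) / x) ^ n := by
    rw [div_pow, ← mul_div_assoc, le_div_iff₀ (by positivity)]
    exact h2
  refine h3.trans ?_
  have h4 : (1 + x) / x ≤ 3 / ε := by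
    rw [div_le_div_iff₀ hx0 hε, hx]
    nlinarith
  push_cast
  gcongr

/-- Finite nets of the unit sphere, with the number of points that the volume bound gives. -/
theorem exists_sphere_net (hd : 1 ≤ d) {ε : ℝ} (hε : 0 < ε) (hε1 : ε < 1) :
    ∃ N : Finset (EuclideanSpace ℝ (Fin d)), (∀ u ∈ N, ‖u‖ = 1) ∧
      (N.card : ℝ) ≤ 2 * d * (3 / ε) ^ (d - 1) ∧ ∀ x, ∃ u ∈ N, (1 - ε) * ‖x‖ ≤ inner ℝ u x := by
  classical
  -- A separated set of greatest cardinality is a net: a point at distance at least `ε` from all of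
  -- it could be added.
  let p : ℕ → Prop := fun k ↦ ∃ N : Finset (EuclideanSpace ℝ (Fin d)), N.card = k ∧
    (∀ u ∈ N, ‖u‖ = 1) ∧ ∀ u ∈ N, ∀ v ∈ N, u ≠ v → ε ≤ dist u v
  let b : ℕ := ⌊2 * (d : ℝ) * (3 / ε) ^ (d - 1)⌋₊
  have hpb : ∀ k, p k → k ≤ b := by
    rintro k ⟨N, rfl, h1, h2⟩
    exact Nat.le_floor (card_le_of_separated_sphere hd hε hε1 h1 h2)
  have hp0 : p 0 := ⟨∅, by simp⟩
  obtain ⟨N, hcard, h1, h2⟩ := Nat.findGreatest_spec (P := p) (Nat.zero_le b) hp0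
  have hmax : ∀ k, p k → k ≤ N.card := fun k hk ↦ by
    rw [hcard]; exact Nat.le_findGreatest (hpb k hk) hk
  have hnet : ∀ y : EuclideanSpace ℝ (Fin d), ‖y‖ = 1 → ∃ u ∈ N, dist u y < ε := by
    intro y hy
    by_contra! hcon
    have hyN : y ∉ N := fun h ↦ by simpa using (hcon y h).trans_lt' hε
    have := hmax (N.card + 1) ⟨insert y N, Finset.card_insert_of_notMem hyN, ?_, ?_⟩
    · omega
    · intro u hu
      rcases Finset.mem_insert.1 hu with rfl | hu
      exacts [hy, h1 u hu]
    · intro u hu v hv huv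
      rcases Finset.mem_insert.1 hu with rfl | huN <;> rcases Finset.mem_insert.1 hv with rfl | hvN
      · exact absurd rfl huv
      · rw [dist_comm]; exact hcon v hvN
      · exact hcon u huN
      · exact h2 u huN v hvN huv
  refine ⟨N, h1, card_le_of_separated_sphere hd hε hε1 h1 h2, fun x ↦ ?_⟩
  rcases eq_or_ne x 0 with rfl | hx
  -- At `x = 0` only nonemptiness of the net is needed, and `d ≥ 1` provides a unit vector.
  · obtain ⟨u, hu, -⟩ := hnet (EuclideanSpace.single ⟨0, hd⟩ 1) (by simp)
    exact ⟨u, hu, by simp⟩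
  · have hx0 : 0 < ‖x‖ := norm_pos_iff.2 hx
    obtain ⟨u, hu, hdist⟩ := hnet (‖x‖⁻¹ • x) (by rw [norm_smul, norm_inv, norm_norm]; field_simp)
    refine ⟨u, hu, ?_⟩
    have e1 : inner ℝ (‖x‖⁻¹ • x) x = ‖x‖ := by
      rw [real_inner_smul_left, real_inner_self_eq_norm_sq]; field_simp
    have e2 : inner ℝ (‖x‖⁻¹ • x - u) x ≤ ε * ‖x‖ := by
      refine (real_inner_le_norm _ _).trans ?_
      rw [dist_comm, dist_eq_norm] at hdist
      gcongr
    rw [inner_sub_left, e1] at e2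
    linarith

/-- After removing `2d`, raising the dimension by 2 multiplies the remaining factor by `2(n+2)/π ≥
1`; both base cases equal 1. -/
theorem two_mul_le_netConst : ∀ d : ℕ, 1 ≤ d → 2 * (d : ℝ) ≤ netConst d := by
  have key : ∀ n : ℕ, 1 ≤ 2 ^ n * Gamma (((n : ℝ) + 2) / 2) / π ^ ((n : ℝ) / 2) := by
    intro n
    induction n using Nat.twoStepInduction with
    | zero => simp
    | one =>
      have h : Gamma (((1 : ℕ) + 2 : ℝ) / 2) = 1 / 2 * √π := by
        rw [show (((1 : ℕ) : ℝ) + 2) / 2 = 1 / 2 + 1 by norm_num,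
          Gamma_add_one (by norm_num), Gamma_one_half_eq]
      rw [h, Nat.cast_one, ← sqrt_eq_rpow]
      have : √π ≠ 0 := by positivity
      field_simp
      norm_num
    | more n ih _ =>
      have hG : Gamma (((n + 2 : ℕ) + 2 : ℝ) / 2)
          = (((n : ℝ) + 2) / 2) * Gamma (((n : ℝ) + 2) / 2) := by
        rw [← Gamma_add_one (by positivity)]
        congr 1
        push_cast
        ring
      have hπ : π ^ (((n + 2 : ℕ) : ℝ) / 2) = π ^ ((n : ℝ) / 2) * π := by
        rw [← rpow_add_one pi_pos.ne']
        congr 1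
        push_cast
        ring
      have h4 : 1 ≤ 2 * ((n : ℝ) + 2) / π := by
        rw [le_div_iff₀ pi_pos]
        linarith [pi_le_four, n.cast_nonneg (α := ℝ)]
      calc (1 : ℝ) ≤ (2 ^ n * Gamma (((n : ℝ) + 2) / 2) / π ^ ((n : ℝ) / 2))
            * (2 * ((n : ℝ) + 2) / π) := one_le_mul_of_one_le_of_one_le ih h4
        _ = _ := by
          rw [hG, hπ]
          field_simp
          ring
  intro d hd
  obtain ⟨n, rfl⟩ : ∃ n, d = n + 1 := ⟨d - 1, by omega⟩
  have h := key n
  have e : netConst (n + 1) = 2 * ((n + 1 : ℕ) : ℝ)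
      * (2 ^ n * Gamma (((n : ℝ) + 2) / 2) / π ^ ((n : ℝ) / 2)) := by
    unfold netConst
    push_cast
    rw [show (n : ℝ) + 1 + 1 = n + 2 by ring, show (n : ℝ) + 1 - 1 = n by ring]
    ring
  rw [e]
  exact le_mul_of_one_le_right (by positivity) h

end Net

/-! ### The lower Lambert branch -/

section Lambert

open Real

/-- This makes both choices of `λ*` positive. As `sInf` is 0 on empty or unbounded-below sets, the
roots must be bounded below (by `-2/y`) and one must be found below `-1`. -/
theorem lambertWLower_lt_neg_one {α : ℝ} (h0 : 0 < α) (h1 : α < 1) :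
    lambertWLower (-α ^ 2 / exp 1) < -1 := by
  set y : ℝ := α ^ 2 / exp 1 with hy
  have hy0 : 0 < y := by positivity
  have hy1 : y < exp (-1) := by
    rw [hy, exp_neg, ← one_div]
    gcongr
    nlinarith
  have hxy : -α ^ 2 / exp 1 = -y := by rw [hy]; ring
  have hdecay : ∀ w : ℝ, 0 < w → w * exp (-w) ≤ 2 / w := by
    intro w hw
    rw [exp_neg, ← div_eq_mul_inv, div_le_div_iff₀ (exp_pos w) hw]
    have := quadratic_le_exp_of_nonneg hw.le
    nlinarith
  have hbdd : BddBelow {z : ℝ | z * exp z = -y} := by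
    refine ⟨-(2 / y), fun z hz ↦ ?_⟩
    rcases lt_or_ge z 0 with hz0 | hz0
    · have h := hdecay (-z) (by linarith)
      have hz' : z * exp z = -y := hz
      rw [neg_neg, neg_mul, hz', neg_neg, le_div_iff₀ (by linarith)] at h
      have : -z ≤ 2 / y := by rw [le_div_iff₀ hy0]; linarith
      linarith
    · have : 0 < 2 / y := by positivity
      linarith
  obtain ⟨z, hz, hzy⟩ : ∃ z < -1, z * exp z = -y := by
    set M : ℝ := 2 / y + 1 with hM
    have hM1 : 1 ≤ M := by
      have : 0 < 2 / y := by positivity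
      linarith
    have hcont : ContinuousOn (fun z : ℝ ↦ z * exp z) (Set.Icc (-M) (-1)) := by fun_prop
    have hMy : M * exp (-M) ≤ y := by
      refine (hdecay M (by linarith)).trans ?_
      rw [div_le_iff₀ (by linarith), hM, mul_add, mul_div_cancel₀ _ hy0.ne']
      linarith
    obtain ⟨z, hz, hzy⟩ := intermediate_value_Icc' (by linarith : -M ≤ -1) hcont
      (show -y ∈ Set.Icc ((-1) * exp (-1)) ((-M) * exp (-M)) from ⟨by linarith, by linarith⟩)
    refine ⟨z, lt_of_le_of_ne hz.2 ?_, hzy⟩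
    rintro rfl
    simp only at hzy
    linarith
  rw [hxy]
  exact (csInf_le hbdd hzy).trans_lt hz

end Lambert

/-! ### Reduction to standard Gaussian steps -/

section Standardization

open Matrix

variable {d : ℕ} {Ω : Type*} [MeasurableSpace Ω] {P : Measure Ω} [IsProbabilityMeasure P]
  {V : Matrix (Fin d) (Fin d) ℝ} {X : Ω → EuclideanSpace ℝ (Fin d)}

theorem variance_inner_eq (hX : HasGaussianLaw X P)
    (hcov : ∀ a b, cov[fun ω ↦ X ω a, fun ω ↦ X ω b; P] = V a b) (w : EuclideanSpace ℝ (Fin d)) :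
    Var[fun ω ↦ inner ℝ w (X ω); P] = w.ofLp ⬝ᵥ V *ᵥ w.ofLp := by
  have hmem : ∀ i, MemLp (fun ω ↦ X ω i) 2 P := fun i ↦
    (hX.map_fun (EuclideanSpace.proj i)).memLp_two
  have e : (fun ω ↦ inner ℝ w (X ω)) = fun ω ↦ ∑ i, w i * X ω i := by
    ext ω
    simp [PiLp.inner_apply, mul_comm]
  rw [e, variance_fun_sum fun i ↦ (hmem i).const_mul (w i)]
  simp only [covariance_const_mul_left, covariance_const_mul_right, hcov, dotProduct, mulVec,
    Finset.mul_sum]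
  refine Finset.sum_congr rfl fun i _ ↦ Finset.sum_congr rfl fun j _ ↦ ?_
  ring

/-- Quadratic forms of a covariance matrix are variances, so symmetry and positivity of `V` come
from the law even when `H` is not symmetric. -/
theorem posDef_of_covariance (hX : HasGaussianLaw X P)
    (hcov : ∀ a b, cov[fun ω ↦ X ω a, fun ω ↦ X ω b; P] = V a b) (hV : IsUnit V) : V.PosDef := by
  have hpsd : V.PosSemidef := by
    refine PosSemidef.of_dotProduct_mulVec_nonneg ?_ fun x ↦ ?_
    · ext a b
      simp only [conjTranspose_apply, star_trivial, ← hcov]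
      exact covariance_comm _ _
    · have := variance_inner_eq hX hcov (WithLp.toLp 2 x)
      rw [star_trivial]
      exact this ▸ variance_nonneg _ _
  exact hpsd.posDef_iff_isUnit.2 hV

theorem inv_sqrt_isHermitian (V : Matrix (Fin d) (Fin d) ℝ) : ((CFC.sqrt V)⁻¹).IsHermitian :=
  (nonneg_iff_posSemidef.1 (CFC.sqrt_nonneg V)).isHermitian.inv

theorem inv_sqrt_mul_mul (hV : V.PosDef) : (CFC.sqrt V)⁻¹ * V * (CFC.sqrt V)⁻¹ = 1 := by
  have hsq : CFC.sqrt V * CFC.sqrt V = V :=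
    CFC.sqrt_mul_sqrt_self V (nonneg_iff_posSemidef.2 hV.posSemidef)
  have hdet : IsUnit (CFC.sqrt V).det := by
    have h := (isUnit_iff_isUnit_det V).1 hV.isUnit
    rw [← hsq, det_mul] at h
    exact isUnit_of_mul_isUnit_left h
  nth_rw 2 [← hsq]
  rw [← Matrix.mul_assoc, nonsing_inv_mul _ hdet, Matrix.one_mul, mul_nonsing_inv _ hdet]

/-- Characteristic functions agree, since `V^{-1/2} V V^{-1/2} = 1` turns the variance in direction
`t` into `‖t‖²`. -/
theorem map_standardize_eq_stdGaussian (hX : HasGaussianLaw X P) (hmean : ∫ ω, X ω ∂P = 0)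
    (hcov : ∀ a b, cov[fun ω ↦ X ω a, fun ω ↦ X ω b; P] = V a b) (hV : V.PosDef) :
    P.map (fun ω ↦ standardize V (X ω)) = stdGaussian (EuclideanSpace ℝ (Fin d)) := by
  set R := (CFC.sqrt V)⁻¹ with hR
  have hRT : Rᵀ = R := by
    rw [← conjTranspose_eq_transpose_of_trivial]
    exact inv_sqrt_isHermitian V
  have hY : HasGaussianLaw (fun ω ↦ standardize V (X ω)) P :=
    hX.map_fun (toEuclideanCLM (𝕜 := ℝ) R)
  have : IsProbabilityMeasure (P.map fun ω ↦ standardize V (X ω)) :=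
    Measure.isProbabilityMeasure_map hY.aemeasurable
  refine Measure.ext_of_charFun ?_
  ext t
  have hinner : ∀ x, inner ℝ t (standardize V x) = inner ℝ (WithLp.toLp 2 (R *ᵥ t.ofLp)) x := by
    intro x
    simp only [standardize, EuclideanSpace.inner_eq_star_dotProduct, star_trivial,
      ofLp_toEuclideanCLM, ← hR]
    rw [dotProduct_comm, dotProduct_mulVec, ← mulVec_transpose, hRT, dotProduct_comm]
  rw [hY.charFun_map_eq, charFun_stdGaussian]
  simp only [hinner]
  rw [variance_inner_eq hX hcov, integral_inner hX.integrable, hmean]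
  have hquad : (R *ᵥ t.ofLp) ⬝ᵥ V *ᵥ (R *ᵥ t.ofLp) = ‖t‖ ^ 2 := by
    rw [mulVec_mulVec, dotProduct_comm, dotProduct_mulVec, ← mulVec_transpose, hRT,
      mulVec_mulVec, ← Matrix.mul_assoc, inv_sqrt_mul_mul hV, one_mulVec,
      EuclideanSpace.real_norm_sq_eq]
    simp [dotProduct, sq]
  rw [hquad]
  simp [neg_div]

theorem one_le_condNumber (hd : 1 ≤ d) (hV : V.PosDef) : 1 ≤ condNumber V := by
  have : Nontrivial (EuclideanSpace ℝ (Fin d)) := by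
    have : Nonempty (Fin d) := ⟨⟨0, hd⟩⟩
    infer_instance
  have hdet := (isUnit_iff_isUnit_det V).1 hV.isUnit
  calc (1 : ℝ) = ‖toEuclideanCLM (𝕜 := ℝ) (V * V⁻¹)‖ := by
        rw [mul_nonsing_inv _ hdet, map_one, norm_one]
    _ ≤ condNumber V := by rw [map_mul]; exact norm_mul_le _ _

end Standardization

end TimeUniform

end

noncomputable section

namespace TimeUniform

/-! ### From crossing bounds to the three regions -/

section Regions

open Real

variable {d : ℕ} {Ω : Type*}

/-- Subadditivity alone suffices, so the good event need not be shown measurable. -/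
theorem one_sub_le_real_of_measure_le [MeasurableSpace Ω] {P : Measure Ω} [IsProbabilityMeasure P]
    {A B : Set Ω} {α : ℝ} (hα : 0 ≤ α)
    (hB : P B ≤ ENNReal.ofReal α) (hAB : ∀ᵐ ω ∂P, ω ∉ B → ω ∈ A) : 1 - α ≤ P.real A := by
  have h1 : (1 : ENNReal) ≤ P A + P B := by
    calc (1 : ENNReal) = P Set.univ := measure_univ.symm
      _ ≤ P (A ∪ B) := measure_mono_ae (by
          filter_upwards [hAB] with ω hω _
          by_cases h : ω ∈ B
          exacts [Or.inr h, Or.inl (hω h)])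
      _ ≤ _ := measure_union_le _ _
  have h2 := ENNReal.toReal_mono (by finiteness) h1
  rw [ENNReal.toReal_add (by finiteness) (by finiteness)] at h2
  have h3 := ENNReal.toReal_le_of_le_ofReal hα hB
  simp only [ENNReal.toReal_one] at h2
  change 1 - α ≤ (P A).toReal
  linarith

/-- The union bound over finitely many directions. -/
theorem measure_lil_crossing_finset_le [MeasurableSpace Ω] {P : Measure Ω} [IsProbabilityMeasure P]
    {Z : ℕ → Ω → EuclideanSpace ℝ (Fin d)}
    (hZ : ∀ j, Measurable (Z j)) (hindep : iIndepFun Z P)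
    (hlaw : ∀ j, P.map (Z j) = stdGaussian (EuclideanSpace ℝ (Fin d)))
    {N : Finset (EuclideanSpace ℝ (Fin d))} (hN : ∀ u ∈ N, ‖u‖ = 1) {C : ℝ} (hC : 1 ≤ C)
    (hcard : (N.card : ℝ) ≤ C) {α : ℝ} (hα : 0 < α) (hα1 : α < 1) :
    P {ω | ∃ u ∈ N, ∃ t : ℕ, 1 ≤ t ∧
      1.7 * √(t * lilArg (α / C) t) < inner ℝ u (∑ j ∈ Finset.range t, Z j ω)}
      ≤ ENNReal.ofReal α := by
  have hC0 : 0 < C := by linarith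
  have ha : 0 < α / C := by positivity
  have ha1 : α / C < 1 := by rw [div_lt_one hC0]; linarith
  calc _ ≤ P (⋃ u ∈ N, {ω | ∃ t : ℕ, 1 ≤ t ∧
        1.7 * √(t * lilArg (α / C) t) < inner ℝ u (∑ j ∈ Finset.range t, Z j ω)}) :=
        measure_mono (by
          rintro ω ⟨u, hu, h⟩
          exact Set.mem_biUnion hu h)
    _ ≤ ∑ u ∈ N, P {ω | ∃ t : ℕ, 1 ≤ t ∧
        1.7 * √(t * lilArg (α / C) t) < inner ℝ u (∑ j ∈ Finset.range t, Z j ω)} :=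
        measure_biUnion_finset_le _ _
    _ ≤ ∑ u ∈ N, ENNReal.ofReal (α / C) := Finset.sum_le_sum fun u hu ↦
        measure_lil_crossing_le hZ hindep hlaw (hN u hu) ha ha1
    _ = ENNReal.ofReal (N.card * (α / C)) := by
        rw [Finset.sum_const, nsmul_eq_mul, ENNReal.ofReal_mul (by positivity),
          ENNReal.ofReal_natCast]
    _ ≤ ENNReal.ofReal α := by
        refine ENNReal.ofReal_le_ofReal ?_
        calc N.card * (α / C) ≤ C * (α / C) := by gcongr
          _ = α := by field_simp

theorem inv_mul_sqrt_mul {t : ℝ} (ht : 0 < t) (x : ℝ) : t⁻¹ * √(t * x) = √(x / t) := by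
  have h : x / t = t⁻¹ ^ 2 * (t * x) := by field_simp
  rw [h, sqrt_mul (sq_nonneg t⁻¹), sqrt_sq (by positivity)]

theorem standardize_runningMean (V : Matrix (Fin d) (Fin d) ℝ)
    (G : ℕ → Ω → EuclideanSpace ℝ (Fin d)) (t : ℕ) (ω : Ω) :
    standardize V (runningMean G t ω)
      = (t : ℝ)⁻¹ • ∑ j ∈ Finset.range t, standardize V (G j ω) := by
  simp only [standardize, runningMean, map_smul, map_sum]

theorem runningMean_mem_regionLILUB {V : Matrix (Fin d) (Fin d) ℝ}
    {G : ℕ → Ω → EuclideanSpace ℝ (Fin d)} {α : ℝ} {t : ℕ} (ht : 1 ≤ t) {ω : Ω}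
    (h : ∀ (i : Fin d) (s : ℝ), s = 1 ∨ s = -1 →
      inner ℝ (EuclideanSpace.single i s) (∑ j ∈ Finset.range t, standardize V (G j ω))
        ≤ 1.7 * √(t * lilArg (α / (2 * d)) t)) :
    runningMean G t ω ∈ regionLILUB V α t := by
  have ht' : (0 : ℝ) < t := by exact_mod_cast ht
  change ‖(WithLp.ofLp (standardize V (runningMean G t ω)) : Fin d → ℝ)‖ ≤ _
  rw [pi_norm_le_iff_of_nonneg (by positivity), standardize_runningMean]
  set S := ∑ j ∈ Finset.range t, standardize V (G j ω)
  intro i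
  have harg : log (log (2 * t)) + 0.72 * log (10.4 * d / α) = lilArg (α / (2 * d)) t := by
    rw [lilArg, div_div_eq_mul_div]
    ring_nf
  rw [harg, ← inv_mul_sqrt_mul ht', mul_left_comm, PiLp.smul_apply, norm_smul, norm_inv,
    Real.norm_natCast]
  refine mul_le_mul_of_nonneg_left ?_ (by positivity)
  have h1 := h i 1 (Or.inl rfl)
  have h2 := h i (-1) (Or.inr rfl)
  simp only [EuclideanSpace.inner_single_left, conj_trivial, one_mul, neg_mul] at h1 h2
  rw [Real.norm_eq_abs, abs_le]
  constructor <;> linarith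

theorem runningMean_mem_regionGM {V : Matrix (Fin d) (Fin d) ℝ}
    {G : ℕ → Ω → EuclideanSpace ℝ (Fin d)} {α t₀ lam : ℝ} (ht₀ : 0 < t₀) (hlam : 0 < lam)
    {t : ℕ} (ht : 1 ≤ t) {ω : Ω}
    (h : ‖∑ j ∈ Finset.range t, standardize V (G j ω)‖ ^ 2 ≤
      (t + t₀ / lam) * (d * log (1 + t / (t₀ / lam)) + 2 * log α⁻¹)) :
    runningMean G t ω ∈ regionGM V α t₀ lam t := by
  have ht' : (0 : ℝ) < t := by exact_mod_cast ht
  change ‖standardize V (runningMean G t ω)‖ ≤ _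
  rw [standardize_runningMean, norm_smul, norm_inv, Real.norm_natCast]
  refine le_sqrt_of_sq_le ?_
  rw [div_div_eq_mul_div] at h
  rw [mul_pow, one_div]
  calc (t : ℝ)⁻¹ ^ 2 * ‖∑ j ∈ Finset.range t, standardize V (G j ω)‖ ^ 2
      ≤ (t : ℝ)⁻¹ ^ 2 * ((t + t₀ / lam) * (d * log (1 + t * lam / t₀) + 2 * log α⁻¹)) := by
        gcongr
    _ = _ := by
        field_simp

/-- Comparison of the two iterated-logarithm boundaries. -/
theorem sqrt_lilArg_le_sqrt_net (hd : 1 ≤ d) {V : Matrix (Fin d) (Fin d) ℝ}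
    (hκ : 1 ≤ condNumber V) {α ε : ℝ} (hα : 0 < α) (hα1 : α < 1) (hε : 0 < ε) (hε1 : ε < 1)
    {t : ℕ} (ht : 1 ≤ t) :
    1.7 * √(lilArg (α / (2 * d * (3 / ε) ^ (d - 1))) t / t)
      ≤ 2 * √((1.4 * log (log (2 * t * condNumber V)) + netLog V ε α) / t) := by
  have ht' : (1 : ℝ) ≤ t := by exact_mod_cast ht
  have hd' : (1 : ℝ) ≤ d := by exact_mod_cast hd
  have h2 : 0.69 < log 2 := by have := log_two_gt_d9; norm_num at this ⊢; linarith
  have hlog2t : log 2 ≤ log (2 * t) := log_le_log (by norm_num) (by linarith)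
  have hll : log (log 2) ≤ log (log (2 * t)) := log_le_log (by linarith) hlog2t
  -- At `t = 1` the iterated logarithm is negative, so raising its coefficient from `1.7²` to `4 *
  -- 1.4` may lose; the surplus of the `log (5.2 C / α)` term pays.
  have hll2 : -0.5 ≤ log (log 2) := by
    have := one_sub_inv_le_log_of_pos (x := log 2) (by linarith)
    have h3 : (log 2)⁻¹ ≤ 1.5 := by
      rw [inv_le_comm₀ (by linarith) (by norm_num)]
      norm_num at *; linarith
    norm_num at *; linarith
  have hκt : log (log (2 * t)) ≤ log (log (2 * t * condNumber V)) := by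
    refine log_le_log (by linarith) (log_le_log (by linarith) ?_)
    exact le_mul_of_one_le_right (by linarith) hκ
  set C : ℝ := 2 * d * (3 / ε) ^ (d - 1) with hC
  have h3ε : 1 ≤ 3 / ε := by rw [one_le_div hε]; linarith
  have hpow : 1 ≤ (3 / ε) ^ (d - 1) := one_le_pow₀ h3ε
  have hC1 : 1 ≤ C := by rw [hC]; nlinarith
  have hnet : log (5.2 / (α / C)) ≤ netLog V ε α := by
    have e : log (5.2 / (α / C)) = log (5.2 * (2 * d) / α) + ((d : ℝ) - 1) * log (3 / ε) := by
      rw [show 5.2 / (α / C) = (5.2 * (2 * d) / α) * (3 / ε) ^ (d - 1) by rw [hC]; field_simp,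
        log_mul (by positivity) (by positivity), log_pow, Nat.cast_sub hd, Nat.cast_one]
    rw [e, netLog]
    refine add_le_add (log_le_log (by positivity) ?_) ?_
    · have := two_mul_le_netConst d hd
      gcongr
    · refine mul_le_mul_of_nonneg_left (log_le_log (by positivity) ?_) (by linarith)
      gcongr
      have : 1 ≤ √(condNumber V) := one_le_sqrt.2 hκ
      linarith
  have hlogC : 1 ≤ log (5.2 / (α / C)) := by
    rw [le_log_iff_exp_le (by positivity)]
    have h1 : exp 1 ≤ 5.2 := by have := exp_one_lt_d9; norm_num at this ⊢; linarith
    refine h1.trans ?_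
    rw [le_div_iff₀ (by positivity)]
    have : α / C ≤ 1 := by rw [div_le_one (by linarith)]; linarith
    linarith
  have hmain : 1.7 ^ 2 * lilArg (α / C) t
      ≤ 2 ^ 2 * (1.4 * log (log (2 * t * condNumber V)) + netLog V ε α) := by
    rw [lilArg]
    norm_num at *
    linarith
  have hs : ∀ c x : ℝ, 0 ≤ c → c * √x = √(c ^ 2 * x) := fun c x hc ↦ by
    rw [sqrt_mul (by positivity), sqrt_sq hc]
  rw [hs _ _ (by norm_num), hs _ _ (by norm_num), ← mul_div_assoc, ← mul_div_assoc]
  exact sqrt_le_sqrt (by gcongr)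

theorem runningMean_mem_regionLILEN (hd : 1 ≤ d) {V : Matrix (Fin d) (Fin d) ℝ}
    (hκ : 1 ≤ condNumber V) {α ε : ℝ} (hα : 0 < α) (hα1 : α < 1) (hε : 0 < ε) (hε1 : ε < 1)
    {G : ℕ → Ω → EuclideanSpace ℝ (Fin d)} {t : ℕ} (ht : 1 ≤ t) {ω : Ω}
    {u : EuclideanSpace ℝ (Fin d)}
    (hu : (1 - ε) * ‖∑ j ∈ Finset.range t, standardize V (G j ω)‖
      ≤ inner ℝ u (∑ j ∈ Finset.range t, standardize V (G j ω)))
    (h : inner ℝ u (∑ j ∈ Finset.range t, standardize V (G j ω))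
      ≤ 1.7 * √(t * lilArg (α / (2 * d * (3 / ε) ^ (d - 1))) t)) :
    runningMean G t ω ∈ regionLILEN V ε α t := by
  have ht' : (0 : ℝ) < t := by exact_mod_cast ht
  change ‖standardize V (runningMean G t ω)‖ ≤ _
  rw [standardize_runningMean, norm_smul, norm_inv, Real.norm_natCast, div_mul_eq_mul_div,
    le_div_iff₀ (by linarith)]
  refine le_trans ?_ (sqrt_lilArg_le_sqrt_net hd hκ hα hα1 hε hε1 ht)
  rw [← inv_mul_sqrt_mul ht', mul_left_comm, mul_assoc]
  refine mul_le_mul_of_nonneg_left ?_ (by positivity)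
  linarith

end Regions

end TimeUniform

end

/-! ### Assembly of the three claims -/

theorem mainTheorem5 {Ω : Type*} [MeasurableSpace Ω] (P : Measure Ω) [IsProbabilityMeasure P]
    {d : ℕ} (hd : 1 ≤ d) (H S : Matrix (Fin d) (Fin d) ℝ) (hH : IsUnit H) (hS : S.PosDef)
    (G : ℕ → Ω → EuclideanSpace ℝ (Fin d))
    (hindep : iIndepFun G P)
    (hgauss : ∀ j, HasGaussianLaw (G j) P)
    (hmean : ∀ j, ∫ ω, G j ω ∂P = 0)
    (hcov : ∀ j a b, cov[fun ω ↦ G j ω a, fun ω ↦ G j ω b; P] = (H⁻¹ * S * H⁻¹) a b)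
    (α : ℝ) (hα : α ∈ Set.Ioo (0 : ℝ) 1) :
    1 - α ≤ P.real {ω | ∀ t : ℕ, 1 ≤ t →
        TimeUniform.runningMean G t ω ∈ TimeUniform.regionLILUB (H⁻¹ * S * H⁻¹) α t} ∧
    (∀ t₀ : ℝ, 0 < t₀ →
      ∀ lam ∈ ({-TimeUniform.lambertWLower (-α ^ 2 / Real.exp 1),
          -TimeUniform.lambertWLower (-α ^ 2 / Real.exp 1) - 1} : Set ℝ),
        1 - α ≤ P.real {ω | ∀ t : ℕ, 1 ≤ t →
          TimeUniform.runningMean G t ω ∈ TimeUniform.regionGM (H⁻¹ * S * H⁻¹) α t₀ lam t}) ∧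
    (∀ ε ∈ Set.Ioo (0 : ℝ) 1,
      1 - α ≤ P.real {ω | ∀ t : ℕ, 1 ≤ t →
        TimeUniform.runningMean G t ω ∈ TimeUniform.regionLILEN (H⁻¹ * S * H⁻¹) ε α t}) := by
  classical
  obtain ⟨hα0, hα1⟩ := hα
  have hd' : (1 : ℝ) ≤ d := by exact_mod_cast hd
  have hVunit : IsUnit (H⁻¹ * S * H⁻¹) := by
    have hHinv : IsUnit H⁻¹ := by simpa using hH
    exact (hHinv.mul hS.isUnit).mul hHinv
  generalize H⁻¹ * S * H⁻¹ = V at *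
  have hV : V.PosDef := TimeUniform.posDef_of_covariance (hgauss 0) (hcov 0) hVunit
  have hκ := TimeUniform.one_le_condNumber hd hV
  have hstd : Measurable (TimeUniform.standardize V) :=
    (Matrix.toEuclideanCLM (𝕜 := ℝ) (CFC.sqrt V)⁻¹).continuous.measurable
  have hGm := fun j ↦ (hgauss j).aemeasurable
  -- The `G j` are only almost everywhere measurable; Ville's inequality is applied to measurable
  -- versions, equal for all `j` off one null set.
  let Z : ℕ → Ω → EuclideanSpace ℝ (Fin d) := fun j ω ↦
    TimeUniform.standardize V ((hGm j).mk (G j) ω)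
  have hZ : ∀ j, Measurable (Z j) := fun j ↦ hstd.comp (hGm j).measurable_mk
  have hGZ : ∀ᵐ ω ∂P, ∀ j, TimeUniform.standardize V (G j ω) = Z j ω := by
    rw [ae_all_iff]
    intro j
    filter_upwards [(hGm j).ae_eq_mk] with ω hω
    simp only [Z, ← hω]
  have hZindep : iIndepFun Z P :=
    (hindep.congr fun j ↦ (hGm j).ae_eq_mk).comp (fun _ ↦ TimeUniform.standardize V) fun _ ↦ hstd
  have hlaw : ∀ j, P.map (Z j) = stdGaussian (EuclideanSpace ℝ (Fin d)) := fun j ↦ by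
    rw [← TimeUniform.map_standardize_eq_stdGaussian (hgauss j) (hmean j) (hcov j) hV]
    refine Measure.map_congr ?_
    filter_upwards [hGZ] with ω hω
    exact (hω j).symm
  refine ⟨?_, fun t₀ ht₀ lam hlam ↦ ?_, fun ε hε ↦ ?_⟩
  · let N : Finset (EuclideanSpace ℝ (Fin d)) :=
      (Finset.univ ×ˢ {1, -1} : Finset (Fin d × ℝ)).image fun p ↦ EuclideanSpace.single p.1 p.2
    have hN : ∀ u ∈ N, ‖u‖ = 1 := by
      intro u hu
      obtain ⟨p, hp, rfl⟩ := Finset.mem_image.1 hu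
      simp only [Finset.mem_product, Finset.mem_insert, Finset.mem_singleton] at hp
      rcases hp.2 with h | h <;> simp [h]
    have hcard : (N.card : ℝ) ≤ 2 * d := by
      have h1 : N.card ≤ d * 2 := Finset.card_image_le.trans (by
        rw [Finset.card_product, Finset.card_univ, Fintype.card_fin]
        exact Nat.mul_le_mul_left _ Finset.card_le_two)
      calc (N.card : ℝ) ≤ ((d * 2 : ℕ) : ℝ) := by exact_mod_cast h1
        _ = 2 * d := by push_cast; ring
    refine TimeUniform.one_sub_le_real_of_measure_le hα0.le
      (TimeUniform.measure_lil_crossing_finset_le hZ hZindep hlaw hN (by linarith) hcard hα0 hα1) ?_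
    filter_upwards [hGZ] with ω hω hgood t ht
    refine TimeUniform.runningMean_mem_regionLILUB ht fun i s hs ↦ ?_
    simp only [hω]
    by_contra! hcon
    refine hgood ⟨EuclideanSpace.single i s, Finset.mem_image.2 ⟨(i, s), ?_, rfl⟩, t, ht, hcon⟩
    simpa using hs
  · have hW := TimeUniform.lambertWLower_lt_neg_one hα0 hα1
    have hlam0 : 0 < lam := by
      rcases hlam with rfl | rfl <;> linarith
    refine TimeUniform.one_sub_le_real_of_measure_le hα0.le
      (TimeUniform.measure_mixture_crossing_le hZ hZindep hlaw (div_pos ht₀ hlam0) hα0) ?_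
    filter_upwards [hGZ] with ω hω hgood t ht
    refine TimeUniform.runningMean_mem_regionGM ht₀ hlam0 ht ?_
    simp only [hω]
    by_contra! hcon
    exact hgood ⟨t, hcon.le⟩
  · obtain ⟨N, hN, hcard, hnet⟩ := TimeUniform.exists_sphere_net hd hε.1 hε.2
    have hC : 1 ≤ 2 * (d : ℝ) * (3 / ε) ^ (d - 1) := by
      have : 1 ≤ (3 / ε) ^ (d - 1) :=
        one_le_pow₀ (by rw [one_le_div hε.1]; linarith [hε.2])
      nlinarith
    refine TimeUniform.one_sub_le_real_of_measure_le hα0.le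
      (TimeUniform.measure_lil_crossing_finset_le hZ hZindep hlaw hN hC hcard hα0 hα1) ?_
    filter_upwards [hGZ] with ω hω hgood t ht
    obtain ⟨u, hu, hux⟩ := hnet (∑ j ∈ Finset.range t, Z j ω)
    refine TimeUniform.runningMean_mem_regionLILEN hd hκ hα0 hα1 hε.1 hε.2 ht (u := u) ?_ ?_
    · simpa only [hω] using hux
    · simp only [hω]
      by_contra! hcon
      exact hgood ⟨u, hu, t, ht, hcon⟩
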